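/- Let $\mathbf{Bicat}$ be the tricategory of bicategories, homomorphisms (pseudofunctors), pseudonatural transformations and modifications, and let $\mathbf{Gray}$ be its subtricategory of 2-categories, 2-functors, all pseudonatural transformations between these, and all modifications. A homomorphism of bicategories is a biequivalence if it is an equivalence on all hom-categories and every object of its codomain is equivalent to one in its image. A trihomomorphism $T\colon\mathcal K\to\mathcal L$ is locally a biequivalence if all the homomorphisms $\mathcal K(X,Y)\to\mathcal L(TX,TY)$ are biequivalences, and it is a triequivalence if moreover every object of $\mathcal L$ is biequivalent in $\mathcal L$ to one of the form $TX$. **Lemma.** The inclusion $\mathbf{Gray}\to\mathbf{Bicat}$ is not a triequivalence; indeed it is not locally a biequivalence, and there are 2-categories $\mathcal A,\mathcal B$ and a homomorphism $\mathcal A\to\mathcal B$ that is not pseudonaturally equivalent to any 2-functor. Explicitly, let $\mathcal A$ be the 2-category with one object, with 1-cells $1$ and $f$ such that $f^2=1$, and with no non-identity 2-cells (the group $\mathbb Z/2$), and let $\mathcal B$ be the 2-category with one object, with a 1-cell $n$ for each integer $n$, composed by addition, and with a 2-cell $n\to m$, then unique and invertible, if and only if $n-m$ is even (the pseudo-quotient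 of $\mathbb Z$ by $2\mathbb Z$). Then there is a homomorphism $\mathcal A\to\mathcal B$ sending $f$ to $1$; there is exactly one 2-functor $\mathcal A\to\mathcal B$, and it sends $f$ to $0$; and no homomorphism $\mathcal A\to\mathcal B$ sending $f$ to $1$ is pseudonaturally equivalent to a 2-functor. -/

import Mathlib

open CategoryTheory Bicategory
open scoped CategoryTheory.Pseudofunctor.StrongTrans

universe w v u w₁ v₁ u₁ t₁ w₂ v₂ u₂ t₂

set_option linter.checkUnivs false

/-! ### Biequivalences -/

section Biequivalence

variable {B : Type u₁} [Bicategory.{w₁, v₁} B] {C : Type u₂} [Bicategory.{w₂, v₂} C]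

/-- Two objects of a bicategory are equivalent (an equivalence can always be completed to an
adjoint equivalence, which is what Mathlib's `Bicategory.Equivalence` records). -/
def AreEquivalent (a b : B) : Prop :=
  Nonempty (Bicategory.Equivalence a b)

/-- A homomorphism of bicategories is a biequivalence if it is an equivalence on all
hom-categories and is biessentially surjective on objects. -/
structure IsBiequivalence (T : B ⥤ᵖ C) : Prop where
  locally_equivalence : ∀ a b : B, (T.mapFunctor a b).IsEquivalence
  biessentially_surjective : ∀ c : C, ∃ a : B, AreEquivalent (T.obj a) c

end Biequivalence

/-! ### Three-dimensional structures and triequivalences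

The definition of a triequivalence involves only the following part of the structure of a
tricategory and of a trihomomorphism: the objects, the hom-bicategories, the identities and
composites of 1-cells, and the induced homomorphisms between hom-bicategories.  The constraint
cells of the tricategories and of the trihomomorphism play no role in it, and are not recorded. -/

/-- The underlying data of a tricategory that are needed to speak of triequivalences: objects,
hom-bicategories (whose objects, 1-cells and 2-cells are the 1-cells, 2-cells and 3-cells of the
tricategory), identity 1-cells and composition of 1-cells. -/
structure TricategoryData where
  Obj : Type t₁
  Hom : Obj → Obj → Type u₁
  bicategory : ∀ X Y : Obj, Bicategory.{w₁, v₁} (Hom X Y)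
  id : ∀ X : Obj, Hom X X
  comp : ∀ {X Y Z : Obj}, Hom X Y → Hom Y Z → Hom X Z

attribute [instance] TricategoryData.bicategory

/-- Two objects `X`, `Y` of a tricategory are biequivalent in it if there are 1-cells
`f : X → Y` and `g : Y → X` whose two composites are equivalent to the identities, in the
hom-bicategories. -/
def TricategoryData.Biequivalent (K : TricategoryData.{w₁, v₁, u₁, t₁}) (X Y : K.Obj) : Prop :=
  ∃ (f : K.Hom X Y) (g : K.Hom Y X),
    AreEquivalent (K.comp f g) (K.id X) ∧ AreEquivalent (K.comp g f) (K.id Y)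

/-- The underlying data of a trihomomorphism that are needed to speak of triequivalences: the
map on objects and the homomorphisms between hom-bicategories, compatible with identities and
composition of 1-cells up to equivalence. -/
structure TrihomomorphismData (K : TricategoryData.{w₁, v₁, u₁, t₁})
    (L : TricategoryData.{w₂, v₂, u₂, t₂}) where
  obj : K.Obj → L.Obj
  hom : ∀ X Y : K.Obj, K.Hom X Y ⥤ᵖ L.Hom (obj X) (obj Y)
  map_id : ∀ X : K.Obj, AreEquivalent ((hom X X).obj (K.id X)) (L.id (obj X))
  map_comp : ∀ {X Y Z : K.Obj} (f : K.Hom X Y) (g : K.Hom Y Z),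
    AreEquivalent ((hom X Z).obj (K.comp f g)) (L.comp ((hom X Y).obj f) ((hom Y Z).obj g))

namespace TrihomomorphismData

variable {K : TricategoryData.{w₁, v₁, u₁, t₁}} {L : TricategoryData.{w₂, v₂, u₂, t₂}}

/-- `T` is locally a biequivalence. -/
def IsLocallyBiequivalence (T : TrihomomorphismData K L) : Prop :=
  ∀ X Y : K.Obj, IsBiequivalence (T.hom X Y)

/-- `T` is triessentially surjective on objects. -/
def IsTriessentiallySurjective (T : TrihomomorphismData K L) : Prop :=
  ∀ Z : L.Obj, ∃ X : K.Obj, L.Biequivalent (T.obj X) Z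

/-- `T` is a triequivalence. -/
structure IsTriequivalence (T : TrihomomorphismData K L) : Prop where
  locally_biequivalence : T.IsLocallyBiequivalence
  triessentially_surjective : T.IsTriessentiallySurjective

end TrihomomorphismData

/-! ### Bicat, Gray and the inclusion -/

/-- A bicategory, bundled. -/
structure BundledBicategory where
  carrier : Type u
  [str : Bicategory.{w, v} carrier]

/-- A 2-category (a strict bicategory), bundled. -/
structure BundledTwoCategory where
  carrier : Type u
  [str : Bicategory.{w, v} carrier]
  [strict : Bicategory.Strict carrier]

attribute [instance] BundledBicategory.str BundledTwoCategory.str BundledTwoCategory.strict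

/-- The bicategory underlying a 2-category. -/
abbrev BundledTwoCategory.toBicategory (A : BundledTwoCategory.{w, v, u}) :
    BundledBicategory.{w, v, u} :=
  ⟨A.carrier⟩

/-- For 2-categories `A` and `B`, the 2-functors from `A` to `B` with all pseudonatural
transformations between them and all modifications between those. -/
abbrev TwoFunctors (A : Type u₁) [Bicategory.{w₁, v₁} A] (B : Type u₂) [Bicategory.{w₂, v₂} B] :=
  InducedBicategory (A ⥤ᵖ B) (fun F : StrictPseudofunctor A B => F.toPseudofunctor)

/-- Bicategories, homomorphisms, pseudonatural transformations, modifications. -/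
abbrev Bicat : TricategoryData where
  Obj := BundledBicategory.{w, v, u}
  Hom A B := A.carrier ⥤ᵖ B.carrier
  bicategory _ _ := inferInstance
  id A := Pseudofunctor.id A.carrier
  comp F G := F.comp G

/-- 2-categories, 2-functors, pseudonatural transformations, modifications. -/
abbrev Gray : TricategoryData where
  Obj := BundledTwoCategory.{w, v, u}
  Hom A B := TwoFunctors A.carrier B.carrier
  bicategory _ _ := inferInstance
  id A := StrictPseudofunctor.id A.carrier
  comp F G := StrictPseudofunctor.comp F G

/-- The inclusion of `Gray` in `Bicat`: it sends a 2-category to itself, a 2-functor to itself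
regarded as a homomorphism, and is the identity on 2-cells and 3-cells. -/
def grayInclusion : TrihomomorphismData Gray.{w, v, u} Bicat.{w, v, u} where
  obj A := A.toBicategory
  hom A B := (InducedBicategory.forget (C := A.carrier ⥤ᵖ B.carrier)
    (F := fun F : StrictPseudofunctor A.carrier B.carrier => F.toPseudofunctor)).toPseudofunctor
  map_id A := ⟨Bicategory.Equivalence.id (Pseudofunctor.id A.carrier)⟩
  map_comp F G := ⟨Bicategory.Equivalence.id
    (Pseudofunctor.comp (StrictPseudofunctor.toStrictlyUnitaryPseudofunctor F).toPseudofunctor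
      (StrictPseudofunctor.toStrictlyUnitaryPseudofunctor G).toPseudofunctor)⟩

/-! ### Pseudo-quotients of monoids -/

/-- The type of objects of the pseudo-quotient of a monoid by a congruence: a single object. -/
inductive PseudoQuotient {M : Type} [AddMonoid M] (c : AddCon M) : Type u
  | star

namespace PseudoQuotient

variable {M : Type} [AddMonoid M] (c : AddCon M)

/-- The 1-cells of the pseudo-quotient of `M` by `c`: the elements of `M`. -/
@[ext]
structure OneCell (_c : AddCon M) : Type v where
  val : M

/-- The 2-cells of the pseudo-quotient of `M` by `c`: there is exactly one from `m` to `n`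
if `c m n`, and there is none otherwise. -/
structure TwoCell (m n : OneCell.{v} c) : Type w where
  rel : c m.val n.val

instance (m n : OneCell.{v} c) : Subsingleton (TwoCell.{w} c m n) :=
  ⟨fun ⟨_⟩ ⟨_⟩ => rfl⟩

instance oneCellCategory : Category.{w} (OneCell.{v} c) where
  Hom m n := TwoCell c m n
  id m := ⟨c.refl m.val⟩
  comp p q := ⟨c.trans p.rel q.rel⟩

instance categoryStruct : CategoryStruct.{v} (PseudoQuotient.{u} c) where
  Hom _ _ := OneCell.{v} c
  id _ := ⟨0⟩
  comp m n := ⟨m.val + n.val⟩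

instance homCategory (x y : PseudoQuotient.{u} c) : Category.{w} (x ⟶ y) :=
  oneCellCategory.{w, v} c

instance {x y : PseudoQuotient.{u} c} (f g : x ⟶ y) :
    Subsingleton (@Quiver.Hom (x ⟶ y) (homCategory.{w, v} c x y).toQuiver f g) :=
  inferInstanceAs (Subsingleton (TwoCell.{w, v} c f g))

/-- The pseudo-quotient of a monoid `M` by a congruence `c`, as a one-object bicategory: 1-cells
are the elements of `M`, composed by addition, and there is a (unique, invertible) 2-cell from
`m` to `n` if and only if `c m n`. -/
instance bicategory : Bicategory.{w, v} (PseudoQuotient.{u} c) where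
  toCategoryStruct := categoryStruct c
  homCategory := homCategory c
  whiskerLeft m _ _ p := ⟨c.add (c.refl (OneCell.val m)) (TwoCell.rel p)⟩
  whiskerRight p n := ⟨c.add (TwoCell.rel p) (c.refl (OneCell.val n))⟩
  associator m n k :=
    eqToIso (OneCell.ext (add_assoc (OneCell.val m) (OneCell.val n) (OneCell.val k)))
  leftUnitor m := eqToIso (OneCell.ext (zero_add (OneCell.val m)))
  rightUnitor m := eqToIso (OneCell.ext (add_zero (OneCell.val m)))
  whiskerLeft_id := by intros; exact Subsingleton.elim _ _
  whiskerLeft_comp := by intros; exact Subsingleton.elim _ _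
  id_whiskerLeft := by intros; exact Subsingleton.elim _ _
  comp_whiskerLeft := by intros; exact Subsingleton.elim _ _
  id_whiskerRight := by intros; exact Subsingleton.elim _ _
  comp_whiskerRight := by intros; exact Subsingleton.elim _ _
  whiskerRight_id := by intros; exact Subsingleton.elim _ _
  whiskerRight_comp := by intros; exact Subsingleton.elim _ _
  whisker_assoc := by intros; exact Subsingleton.elim _ _
  whisker_exchange := by intros; exact Subsingleton.elim _ _
  pentagon := by intros; exact Subsingleton.elim _ _
  triangle := by intros; exact Subsingleton.elim _ _

instance strict : Bicategory.Strict.{w, v} (PseudoQuotient.{u} c) where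
  id_comp m := OneCell.ext (zero_add (OneCell.val m))
  comp_id m := OneCell.ext (add_zero (OneCell.val m))
  assoc m n k := OneCell.ext (add_assoc (OneCell.val m) (OneCell.val n) (OneCell.val k))
  leftUnitor_eqToIso _ := Iso.ext (Subsingleton.elim _ _)
  rightUnitor_eqToIso _ := Iso.ext (Subsingleton.elim _ _)
  associator_eqToIso _ _ _ := Iso.ext (Subsingleton.elim _ _)

end PseudoQuotient

/-- The congruence on `ℤ` that relates `n` and `m` if and only if `n - m` is even. -/
def evenCon : AddCon ℤ where
  r n m := Even (n - m)
  iseqv :=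
    { refl := fun n => by simp
      symm := fun {n m} h => by rw [← neg_sub]; exact h.neg
      trans := fun {n m k} h h' => by
        have := h.add h'
        rwa [sub_add_sub_cancel] at this }
  add' := fun {n m k l} h h' => by
    have := h.add h'
    rwa [← add_sub_add_comm] at this

/-- The group of order 2 as a one-object 2-category with no non-identity 2-cells (the quotient
is by equality). -/
def groupOfOrderTwo : BundledTwoCategory.{w, v, u} :=
  ⟨PseudoQuotient.{u} (⊥ : AddCon (ZMod 2))⟩

/-- The pseudo-quotient of `ℤ` by `2ℤ`. -/
def intModTwo : BundledTwoCategory.{w, v, u} :=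
  ⟨PseudoQuotient.{u} evenCon⟩

/-- The object of the group of order 2. -/
def groupOfOrderTwo.star : groupOfOrderTwo.{w, v, u}.carrier :=
  PseudoQuotient.star

/-- The non-identity 1-cell of the group of order 2. -/
def groupOfOrderTwo.f : groupOfOrderTwo.star.{w, v, u} ⟶ groupOfOrderTwo.star :=
  PseudoQuotient.OneCell.mk (1 : ZMod 2)

/-- The integer that a 1-cell of the pseudo-quotient of `ℤ` by `2ℤ` is. -/
def intModTwo.toInt {x y : intModTwo.{w, v, u}.carrier} (n : x ⟶ y) : ℤ :=
  PseudoQuotient.OneCell.val n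

namespace PseudoQuotient

variable {M N : Type} [AddMonoid M] [AddMonoid N] {c : AddCon M} {d : AddCon N}

/-- Related elements are isomorphic 1-cells of the pseudo-quotient. -/
def isoOfRel (f g : OneCell.{v} c) (h : c f.val g.val) :
    @Iso (OneCell.{v} c) (oneCellCategory.{w, v} c) f g where
  hom := TwoCell.mk h
  inv := TwoCell.mk (c.symm h)
  hom_inv_id := rfl
  inv_hom_id := rfl

/-- A function that respects the congruences induces a prelax functor between
pseudo-quotients. -/
def prelaxFunctor (φ : M → N) (hφ : ∀ m n, c m n → d (φ m) (φ n)) :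
    PrelaxFunctor (PseudoQuotient.{u₁} c) (PseudoQuotient.{u₂} d) where
  obj _ := star
  map m := OneCell.mk (φ (OneCell.val m))
  map₂ p := TwoCell.mk (hφ _ _ (TwoCell.rel p))
  map₂_id _ := Subsingleton.elim _ _
  map₂_comp _ _ := Subsingleton.elim _ _

/-- A function that respects the congruences, and respects zero and addition up to the congruence
on the codomain, induces a homomorphism between pseudo-quotients. -/
def pseudofunctor (φ : M → N) (hφ : ∀ m n, c m n → d (φ m) (φ n)) (h0 : d (φ 0) 0)
    (hadd : ∀ m n, d (φ (m + n)) (φ m + φ n)) :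
    PseudoQuotient.{u₁} c ⥤ᵖ PseudoQuotient.{u₂} d where
  toPrelaxFunctor := prelaxFunctor φ hφ
  mapId _ := isoOfRel _ _ h0
  mapComp m n := isoOfRel _ _ (hadd (OneCell.val m) (OneCell.val n))
  map₂_whisker_left _ _ _ _ := Subsingleton.elim _ _
  map₂_whisker_right _ _ := Subsingleton.elim _ _
  map₂_associator _ _ _ := Subsingleton.elim _ _
  map₂_left_unitor _ := Subsingleton.elim _ _
  map₂_right_unitor _ := Subsingleton.elim _ _

/-- A monoid homomorphism that respects the congruences induces a 2-functor between
pseudo-quotients. -/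
def strictPseudofunctor (φ : M →+ N) (hφ : ∀ m n, c m n → d (φ m) (φ n)) :
    StrictPseudofunctor (PseudoQuotient.{u₁} c) (PseudoQuotient.{u₂} d) where
  toPseudofunctor := pseudofunctor φ hφ (by rw [map_zero]; exact d.refl 0)
    (fun m n => by rw [map_add]; exact d.refl _)
  map_id _ := OneCell.ext (map_zero φ)
  mapId_eq_eqToIso _ := Iso.ext (Subsingleton.elim _ _)
  map_comp m n := OneCell.ext (map_add φ (OneCell.val m) (OneCell.val n))
  mapComp_eq_eqToIso _ _ := Iso.ext (Subsingleton.elim _ _)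

/-- A 2-functor between pseudo-quotients is determined by its action on 1-cells. -/
theorem strictPseudofunctor_ext
    {F G : @StrictPseudofunctor (PseudoQuotient.{u₁} c) (bicategory.{w₁, v₁} c)
      (PseudoQuotient.{u₂} d) (bicategory.{w₂, v₂} d)}
    (h : ∀ m : OneCell.{v₁} c,
      OneCell.val (F.map (X := star) (Y := star) m) =
        OneCell.val (G.map (X := star) (Y := star) m)) : F = G := by
  have hobj : F.obj = G.obj := by
    funext x
    cases F.obj x
    cases G.obj x
    rfl
  obtain ⟨⟨⟨⟨⟨⟨Fo, Fm⟩, Fm₂⟩, _, _⟩, Fi, Fc, _, _, _, _, _⟩, _, _⟩, _, _⟩ := F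
  obtain ⟨⟨⟨⟨⟨⟨Go, Gm⟩, Gm₂⟩, _, _⟩, Gi, Gc, _, _, _, _, _⟩, _, _⟩, _, _⟩ := G
  obtain rfl : Fo = Go := hobj
  obtain rfl : @Fm = @Gm := by
    funext x y m
    cases x
    cases y
    exact OneCell.ext (h m)
  obtain rfl : @Fm₂ = @Gm₂ := by
    funext x y m n p
    exact Subsingleton.elim _ _
  obtain rfl : Fi = Gi := by
    funext x
    exact Iso.ext (Subsingleton.elim _ _)
  obtain rfl : @Fc = @Gc := by
    funext x y z m n
    exact Iso.ext (Subsingleton.elim _ _)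
  rfl

end PseudoQuotient

namespace AreEquivalent

variable {B : Type u₁} [Bicategory.{w₁, v₁} B] {a b : B}

theorem nonempty_hom (h : AreEquivalent a b) : Nonempty (a ⟶ b) :=
  h.map Equivalence.hom

theorem nonempty_inv (h : AreEquivalent a b) : Nonempty (b ⟶ a) :=
  h.map Equivalence.inv

end AreEquivalent

namespace groupOfOrderTwo

theorem f_comp_f : f.{w, v, u} ≫ f = 𝟙 star :=
  PseudoQuotient.OneCell.ext (by decide : (1 : ZMod 2) + 1 = 0)

end groupOfOrderTwo

/-- The homomorphism from the group of order 2 to the pseudo-quotient of `ℤ` by `2ℤ` that sends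
`0` to `0` and `f` to `1`. -/
def groupOfOrderTwoToIntModTwo : groupOfOrderTwo.{w, v, u}.carrier ⥤ᵖ intModTwo.{w, v, u}.carrier :=
  PseudoQuotient.pseudofunctor (c := (⊥ : AddCon (ZMod 2))) (d := evenCon)
    (fun m => (m.val : ℤ))
    (fun m n (h : m = n) => h ▸ evenCon.refl _)
    (evenCon.refl 0)
    (show ∀ m n : ZMod 2, Even (((m + n).val : ℤ) - ((m.val : ℤ) + (n.val : ℤ))) by decide)

/-- The 2-functor from the group of order 2 to the pseudo-quotient of `ℤ` by `2ℤ` that sends every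
1-cell to `0`. -/
def zeroTwoFunctor :
    StrictPseudofunctor groupOfOrderTwo.{w, v, u}.carrier intModTwo.{w, v, u}.carrier :=
  PseudoQuotient.strictPseudofunctor (c := (⊥ : AddCon (ZMod 2))) (d := evenCon) 0
    (fun _ _ _ => evenCon.refl 0)

theorem toInt_map_f_of_strict
    (F : StrictPseudofunctor groupOfOrderTwo.{w, v, u}.carrier intModTwo.{w, v, u}.carrier) :
    intModTwo.toInt (F.map groupOfOrderTwo.f) = 0 := by
  have h : F.map groupOfOrderTwo.f ≫ F.map groupOfOrderTwo.f = 𝟙 _ := by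
    rw [← F.map_comp, groupOfOrderTwo.f_comp_f, F.map_id]
  have h' : intModTwo.toInt (F.map groupOfOrderTwo.f) + intModTwo.toInt (F.map groupOfOrderTwo.f)
      = 0 := congrArg intModTwo.toInt h
  omega

theorem strict_eq_zeroTwoFunctor
    (F : StrictPseudofunctor groupOfOrderTwo.{w, v, u}.carrier intModTwo.{w, v, u}.carrier) :
    F = zeroTwoFunctor := by
  refine PseudoQuotient.strictPseudofunctor_ext (c := (⊥ : AddCon (ZMod 2))) (d := evenCon) ?_
  rintro ⟨m⟩
  change ZMod 2 at m
  obtain rfl | rfl : m = 0 ∨ m = 1 := by revert m; decide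
  · exact congrArg intModTwo.toInt.{w, v, u} (F.map_id groupOfOrderTwo.star)
  · exact toInt_map_f_of_strict F

/-- A pseudonatural transformation between homomorphisms into the pseudo-quotient of `ℤ` by `2ℤ`
forces their values at an endomorphism to have the same parity. -/
theorem even_toInt_sub_of_strongTrans {B : Type u₁} [Bicategory.{w₁, v₁} B]
    {G H : B ⥤ᵖ intModTwo.{w, v, u}.carrier} (η : G ⟶ H) {b : B} (g : b ⟶ b) :
    Even (intModTwo.toInt (G.map g) - intModTwo.toInt (H.map g)) := by
  have h : Even ((intModTwo.toInt (G.map g) + intModTwo.toInt (η.app b)) -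
      (intModTwo.toInt (η.app b) + intModTwo.toInt (H.map g))) :=
    PseudoQuotient.TwoCell.rel (c := evenCon) (η.naturality g).hom
  rwa [add_comm (intModTwo.toInt (η.app b)), add_sub_add_right_eq_sub] at h

theorem isEmpty_strongTrans_strict
    (H : groupOfOrderTwo.{w, v, u}.carrier ⥤ᵖ intModTwo.{w, v, u}.carrier)
    (hH : intModTwo.toInt (H.map groupOfOrderTwo.f) = 1)
    (F : StrictPseudofunctor groupOfOrderTwo.{w, v, u}.carrier intModTwo.{w, v, u}.carrier) :
    IsEmpty (H ⟶ F.toPseudofunctor) := by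
  refine ⟨fun η => ?_⟩
  have h := even_toInt_sub_of_strongTrans η groupOfOrderTwo.f
  rw [hH, toInt_map_f_of_strict F] at h
  revert h
  decide

theorem toInt_groupOfOrderTwoToIntModTwo_map_f :
    intModTwo.toInt (groupOfOrderTwoToIntModTwo.{w, v, u}.map groupOfOrderTwo.f) = 1 :=
  rfl

theorem not_isLocallyBiequivalence_grayInclusion :
    ¬ grayInclusion.{w, v, u}.IsLocallyBiequivalence := by
  intro h
  obtain ⟨F, hF⟩ := (h groupOfOrderTwo intModTwo).biessentially_surjective
    groupOfOrderTwoToIntModTwo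
  obtain ⟨η⟩ := hF.nonempty_inv
  exact (isEmpty_strongTrans_strict _ toInt_groupOfOrderTwoToIntModTwo_map_f F).false η

theorem mainTheorem2 :
    -- the inclusion is not a triequivalence, because it is not locally a biequivalence
    ¬ grayInclusion.{w, v, u}.IsTriequivalence ∧
    ¬ grayInclusion.{w, v, u}.IsLocallyBiequivalence ∧
    -- some homomorphism between 2-categories is not pseudonaturally equivalent to a 2-functor
    (∃ (A B : BundledTwoCategory.{w, v, u}) (H : A.carrier ⥤ᵖ B.carrier),
      ∀ F : StrictPseudofunctor A.carrier B.carrier, ¬ AreEquivalent H F.toPseudofunctor) ∧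
    -- there is a homomorphism from `ℤ/2` to the pseudo-quotient of `ℤ` by `2ℤ` sending `f` to `1`
    (∃ H : groupOfOrderTwo.{w, v, u}.carrier ⥤ᵖ intModTwo.{w, v, u}.carrier,
      intModTwo.toInt (H.map groupOfOrderTwo.f) = 1) ∧
    -- there is exactly one 2-functor between them, and it sends `f` to `0`
    (∃ F : StrictPseudofunctor groupOfOrderTwo.{w, v, u}.carrier intModTwo.{w, v, u}.carrier,
      intModTwo.toInt (F.map groupOfOrderTwo.f) = 0 ∧
      ∀ F' : StrictPseudofunctor groupOfOrderTwo.{w, v, u}.carrier intModTwo.{w, v, u}.carrier,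
        F' = F) ∧
    -- so a homomorphism sending `f` to `1` is not pseudonaturally equivalent to a 2-functor
    (∀ H : groupOfOrderTwo.{w, v, u}.carrier ⥤ᵖ intModTwo.{w, v, u}.carrier,
      intModTwo.toInt (H.map groupOfOrderTwo.f) = 1 →
      ∀ F : StrictPseudofunctor groupOfOrderTwo.{w, v, u}.carrier intModTwo.{w, v, u}.carrier,
        ¬ AreEquivalent H F.toPseudofunctor) := by
  have key (H : groupOfOrderTwo.{w, v, u}.carrier ⥤ᵖ intModTwo.{w, v, u}.carrier)
      (hH : intModTwo.toInt (H.map groupOfOrderTwo.f) = 1)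
      (F : StrictPseudofunctor groupOfOrderTwo.{w, v, u}.carrier intModTwo.{w, v, u}.carrier) :
      ¬ AreEquivalent H F.toPseudofunctor := fun h =>
    h.nonempty_hom.elim (isEmpty_strongTrans_strict H hH F).false
  exact ⟨fun h => not_isLocallyBiequivalence_grayInclusion h.locally_biequivalence,
    not_isLocallyBiequivalence_grayInclusion,
    ⟨groupOfOrderTwo, intModTwo, groupOfOrderTwoToIntModTwo,
      key _ toInt_groupOfOrderTwoToIntModTwo_map_f⟩,
    ⟨groupOfOrderTwoToIntModTwo, toInt_groupOfOrderTwoToIntModTwo_map_f⟩,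
    ⟨zeroTwoFunctor, toInt_map_f_of_strict _, strict_eq_zeroTwoFunctor⟩,
    key⟩
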